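/- **Setting.** A (finite) graph $\Gamma$ is a finite set of half-edges together with a partition of it into corollas (the vertices) and a partition of it into parts of size at most two; the two-element parts form the set $E_\Gamma$ of internal edges, the one-element parts are the external edges. Multiple edges and self-loops are allowed. Let $T$ be a spanning tree of $\Gamma$ (of each component, if $\Gamma$ is disconnected) with edge set $E_T$, and $E_L=E_\Gamma\setminus E_T$. For $e\in E_L$ let $l(T,e)$ be the fundamental cycle, i.e. the unique cycle in $T\cup e$, and $t_e=l(T,e)\cap E_T$; for $B\subseteq E_L$ put $f(B)=\bigcup_{e\in B}t_e$. A pair $(\Gamma,F)$ consists of $\Gamma$ and a spanning forest $F$ obtained from $T$ by removing edges; $T$ is carried along. The set of intact fundamental cycles is $\mathsf L_F=\{l(T,e): e\in E_L,\ t_e\subseteq E_F\}$. Let $H_{GF}$ and $H_{GT}\subseteq H_{GF}$ be the $\mathbb Q$-vector spaces spanned by the pairs $(\Gamma,F)$ and by the pairs $(\Gamma,T)$ (that is, $F=T$), and let $\mathbb I$ be the empty graph. **The coaction on pairs.** $\Delta_{GT}:H_{GF}\to H_{GT}\otimes H_{GF}$ is the linear map with $$\Delta_{GT}((\Gamma,F))=\mathbb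 I\otimes(\Gamma,F)+\sum_{\emptyset\neq p\subseteq\mathsf L_F}(p,t_p)\otimes(\Gamma/p,F/t_p),\qquad t_p=\bigcup_{l(T,e)\in p}t_e .$$ Here $(p,t_p)$ is the subgraph whose internal edges are those of the cycles in $p$, with the full corollas at all of its vertices, and with spanning tree $t_p$. $\Gamma/p$ is the graph in which all edges of cycles in $p$ are contracted, with spanning tree $T/t_p$ and forest $F/t_p$. **The algebra of a fixed parent pair.** For fixed $(\Gamma,T)$ let $\mathcal A$ be the $\mathbb Q$-vector space with basis the symbols $B^{[A_1,A_2]}$, $B\subseteq E_L$, $A_1\subseteq A_2\subseteq f(B)$, with the commutative product $$B_1^{[A_1,A_2]}\cdot B_2^{[A_3,A_4]}=(B_1\cup B_2)^{[A_1\cup A_3,\,A_2\cup A_4]}$$ if $B_1\cap B_2=\emptyset$ and both $A_1,A_3$ and $A_2,A_4$ agree on $f(B_1)\cap f(B_2)$, and $0$ otherwise; the unit is $\emptyset^{[\emptyset,\emptyset]}$. Write $x_{e,[A_1,A_2]}=\{e\}^{[A_1\cap t_e,\,A_2\cap t_e]}$. Let $\Delta_c:\mathcal A\to\mathcal A\otimes\mathcal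 A$ be the linear map $$\Delta_c(B^{[A_1,A_2]})=\sum_{\substack{B_1\subseteq B\\ f(B_1)\cap A_1=\emptyset}}B_1^{[A_1\cap f(B_1),\,A_2\cap f(B_1)]}\otimes(B\setminus B_1)^{[A_1\cap f(B\setminus B_1),\,A_2\cap f(B\setminus B_1)]} .$$ **The map $w$.** It is taken relative to the fixed parent $(\Gamma,T)$, whose edge labels and tree paths are used throughout. For a pair $(\Gamma',F')$ with spanning tree $T'$ such that $E_{T'}\subseteq E_T$ and $E_{\Gamma'}\setminus E_{T'}\subseteq E_L$, put $$w((\Gamma',F'))=\prod_{e}x_{e,[E_{T'}\setminus E_{F'},\,E_T]}\in\mathcal A,$$ the product being over the edges $e\in E_{\Gamma'}\setminus E_{T'}$ whose fundamental cycle in $\Gamma'$ with respect to $T'$ is intact, i.e. has all of its $T'$-edges in $F'$; put $w=0$ on all other pairs and extend linearly. Let $w'$ be defined in the same way with the symbol $B^{[(E_{T'}\setminus E_{F'})\cap f(B),\,E_T\cap f(B)]}$, $B=E_{\Gamma'}\setminus E_{T'}$, in place of the product, so that all fundamental cycles, intact or cut, are recorded. **Lemma.** For every pair $(\Gamma,F)$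 with spanning tree $T\supseteq F$, and with $w,w',\mathcal A,\Delta_c$ formed relative to the parent $(\Gamma,T)$, $$\Delta_c\bigl(w((\Gamma,F))\bigr)=(w\otimes w)\bigl(\Delta_{GT}((\Gamma,F))\bigr),\qquad \Delta_c\bigl(w'((\Gamma,F))\bigr)=(w'\otimes w')\bigl(\Delta_{GT}((\Gamma,F))\bigr).$$ -/

import Mathlib

open scoped TensorProduct

namespace CutGraphs

/-! ## Half-edge graphs -/

/-- A (finite) graph on half-edges drawn from `α`: a finite set `H` of half-edges, a partition `V`
of `H` whose parts are the corollas (vertices), and the set `E` of internal edges, i.e. the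
two-element parts of a partition of `H` into parts of size at most two.  The half-edges in no
internal edge are the external edges (the one-element parts). -/
structure HGraph (α : Type*) [DecidableEq α] where
  H : Finset α
  V : Finpartition H
  E : Finset (Finset α)
  E_sub : ∀ e ∈ E, e ⊆ H
  E_card : ∀ e ∈ E, e.card = 2
  E_disj : (E : Set (Finset α)).PairwiseDisjoint id

variable {α : Type*} [DecidableEq α]

namespace HGraph

/-- Two half-edges are joined by one step through the edge set `X` if they lie in the same corolla,
or are the two halves of an edge in `X`. -/
def Step (Γ : HGraph α) (X : Finset (Finset α)) (a b : α) : Prop :=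
  (∃ v ∈ Γ.V.parts, a ∈ v ∧ b ∈ v) ∨ ∃ e ∈ X, a ∈ e ∧ b ∈ e

/-- Connectedness of half-edges (equivalently of the vertices carrying them) through the edges of
`X`: the equivalence relation generated by `Step`. -/
def conn (Γ : HGraph α) (X : Finset (Finset α)) : Setoid α := Relation.EqvGen.setoid (Γ.Step X)

/-- An edge set is acyclic (a forest) if each of its edges is a bridge of it. -/
def Acyclic (Γ : HGraph α) (X : Finset (Finset α)) : Prop :=
  ∀ e ∈ X, ∀ a ∈ e, ∀ b ∈ e, a ≠ b → ¬ Γ.conn (X.erase e) a b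

/-- A cycle is a minimal edge set that is not acyclic. -/
def IsCycle (Γ : HGraph α) (C : Finset (Finset α)) : Prop :=
  ¬ Γ.Acyclic C ∧ ∀ D, D ⊂ C → Γ.Acyclic D

/-- `T` is the edge set of a spanning tree of `Γ` (of each component, if `Γ` is disconnected). -/
structure IsSpanningTree (Γ : HGraph α) (T : Finset (Finset α)) : Prop where
  sub : T ⊆ Γ.E
  acyclic : Γ.Acyclic T
  spanning : ∀ a b, Γ.conn Γ.E a b → Γ.conn T a b

open Classical in
/-- The fundamental cycle `l(T,e)`: the (unique, for `T` a spanning tree and `e ∉ T`) cycle in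
`T ∪ {e}`, written as the union of all cycles in `T ∪ {e}`. -/
noncomputable def fundCycle (Γ : HGraph α) (T : Finset (Finset α)) (e : Finset α) :
    Finset (Finset α) :=
  ((insert e T).powerset.filter Γ.IsCycle).biUnion id

/-- The half-edges of the corollas met by the edges of `X`. -/
def corollas (Γ : HGraph α) (X : Finset (Finset α)) : Finset (Finset α) :=
  Γ.V.parts.filter fun v => ∃ e ∈ X, ¬ Disjoint e v

/-- The subgraph formed by the edges `X`, with the full corollas at all vertices met by `X`. -/
def subgraph (Γ : HGraph α) (X : Finset (Finset α)) (hX : X ⊆ Γ.E) : HGraph α where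
  H := (Γ.corollas X).sup id
  V := Γ.V.ofSubset (Finset.filter_subset _ _) rfl
  E := X
  E_sub := by
    intro e he a ha
    have haH : a ∈ Γ.H := Γ.E_sub e (hX he) ha
    obtain ⟨v, hv, hav⟩ := Γ.V.exists_mem haH
    rw [Finset.mem_sup]
    exact ⟨v, Finset.mem_filter.2 ⟨hv, e, he, Finset.not_disjoint_iff.2 ⟨a, ha, hav⟩⟩, hav⟩
  E_card := fun e he => Γ.E_card e (hX he)
  E_disj := Γ.E_disj.subset (by exact_mod_cast hX)

open Classical in
/-- The contraction `Γ/X` of the edges `X`: the half-edges of `X` are removed, and all corollas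
connected through `X` are merged. -/
noncomputable def contract (Γ : HGraph α) (X : Finset (Finset α)) (hX : X ⊆ Γ.E) : HGraph α where
  H := Γ.H \ X.biUnion id
  V := Finpartition.ofSetSetoid (Γ.conn X) (Γ.H \ X.biUnion id)
  E := Γ.E \ X
  E_sub := by
    intro e he a ha
    obtain ⟨he, heX⟩ := Finset.mem_sdiff.1 he
    refine Finset.mem_sdiff.2 ⟨Γ.E_sub e he ha, fun h => ?_⟩
    obtain ⟨g, hg, hag⟩ := Finset.mem_biUnion.1 h
    have hne : e ≠ g := fun h => heX (h ▸ hg)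
    exact Finset.disjoint_left.1 (Γ.E_disj he (hX hg) hne) ha hag
  E_card := fun e he => Γ.E_card e (Finset.mem_sdiff.1 he).1
  E_disj := Γ.E_disj.subset (by exact_mod_cast Finset.sdiff_subset)

/-! ### Facts needed to see that sub- and co-graphs inherit spanning trees -/

theorem conn_le {Γ Γ' : HGraph α} {X Y : Finset (Finset α)}
    (h : ∀ a b, Γ.Step X a b → Γ'.conn Y a b) {a b : α} (hab : Γ.conn X a b) : Γ'.conn Y a b := by
  induction hab with
  | rel a b hab => exact h a b hab
  | refl a => exact Setoid.refl' _ a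
  | symm a b _ ih => exact Setoid.symm' _ ih
  | trans a b c _ _ h₁ h₂ => exact Setoid.trans' _ h₁ h₂

theorem conn_step {Γ : HGraph α} {X : Finset (Finset α)} {a b : α} (h : Γ.Step X a b) :
    Γ.conn X a b := Relation.EqvGen.rel _ _ h

theorem conn_edge {Γ : HGraph α} {X : Finset (Finset α)} {e : Finset α} (he : e ∈ X) {a b : α}
    (ha : a ∈ e) (hb : b ∈ e) : Γ.conn X a b := conn_step (Or.inr ⟨e, he, ha, hb⟩)

theorem conn_of_edges {Γ : HGraph α} {X Y : Finset (Finset α)}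
    (h : ∀ e ∈ X, ∀ a ∈ e, ∀ b ∈ e, Γ.conn Y a b) {a b : α} (hab : Γ.conn X a b) :
    Γ.conn Y a b := by
  refine conn_le (fun a b hab => ?_) hab
  rcases hab with hv | ⟨e, he, ha, hb⟩
  · exact conn_step (Or.inl hv)
  · exact h e he a ha b hb

theorem conn_mono {Γ : HGraph α} {X Y : Finset (Finset α)} (h : X ⊆ Y) {a b : α}
    (hab : Γ.conn X a b) : Γ.conn Y a b :=
  conn_of_edges (fun _ he _ ha _ hb => conn_edge (h he) ha hb) hab

theorem Acyclic.mono {Γ : HGraph α} {X Y : Finset (Finset α)} (h : X ⊆ Y) (hY : Γ.Acyclic Y) :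
    Γ.Acyclic X := fun e he a ha b hb hab hc =>
  hY e (h he) a ha b hb hab (conn_mono (Finset.erase_subset_erase e h) hc)

/-- If `X ∪ {e}` connects `a` and `b` then `X` does, or it connects each of them to an end of
`e`. -/
theorem conn_insert {Γ : HGraph α} {X : Finset (Finset α)} {e : Finset α} {a b : α}
    (h : Γ.conn (insert e X) a b) :
    Γ.conn X a b ∨ ∃ u ∈ e, ∃ v ∈ e, Γ.conn X a u ∧ Γ.conn X v b := by
  induction h with
  | rel a b h =>
    rcases h with hv | ⟨g, hg, ha, hb⟩
    · exact Or.inl (conn_step (Or.inl hv))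
    · rcases Finset.mem_insert.1 hg with rfl | hg
      · exact Or.inr ⟨a, ha, b, hb, Setoid.refl' _ a, Setoid.refl' _ b⟩
      · exact Or.inl (conn_edge hg ha hb)
  | refl a => exact Or.inl (Setoid.refl' _ a)
  | symm a b _ ih =>
    rcases ih with h | ⟨u, hu, v, hv, h₁, h₂⟩
    · exact Or.inl (Setoid.symm' _ h)
    · exact Or.inr ⟨v, hv, u, hu, Setoid.symm' _ h₂, Setoid.symm' _ h₁⟩
  | trans a b c _ _ h₁ h₂ =>
    rcases h₁ with h₁ | ⟨u, hu, v, hv, h₁, h₁'⟩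
    · rcases h₂ with h₂ | ⟨u, hu, v, hv, h₂, h₂'⟩
      · exact Or.inl (Setoid.trans' _ h₁ h₂)
      · exact Or.inr ⟨u, hu, v, hv, Setoid.trans' _ h₁ h₂, h₂'⟩
    · rcases h₂ with h₂ | ⟨u', hu', v', hv', h₂, h₂'⟩
      · exact Or.inr ⟨u, hu, v, hv, h₁, Setoid.trans' _ h₁' h₂⟩
      · exact Or.inr ⟨u, hu, v', hv', h₁, h₂'⟩

/-- Every edge set that is not acyclic contains a cycle. -/
theorem exists_isCycle {Γ : HGraph α} {X : Finset (Finset α)} (h : ¬ Γ.Acyclic X) :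
    ∃ C ⊆ X, Γ.IsCycle C := by
  induction X using Finset.strongInduction with
  | H X ih =>
    by_cases hX : ∀ D, D ⊂ X → Γ.Acyclic D
    · exact ⟨X, subset_rfl, h, hX⟩
    · push Not at hX
      obtain ⟨D, hD, hDa⟩ := hX
      obtain ⟨C, hC, hC'⟩ := ih D hD hDa
      exact ⟨C, hC.trans hD.subset, hC'⟩

theorem fundCycle_subset (Γ : HGraph α) (T : Finset (Finset α)) (e : Finset α) :
    Γ.fundCycle T e ⊆ insert e T := by
  intro g hg
  simp only [fundCycle, Finset.mem_biUnion, Finset.mem_filter, Finset.mem_powerset, id] at hg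
  obtain ⟨C, ⟨hC, -⟩, hgC⟩ := hg
  exact hC hgC

/-- A cycle in `T ∪ {e}` connects the ends of `e` by its other edges. -/
theorem IsSpanningTree.conn_erase {Γ : HGraph α} {T C : Finset (Finset α)}
    (hT : Γ.IsSpanningTree T) {e : Finset α} (he : e ∈ Γ.E) (hCT : C ⊆ insert e T)
    (hC : Γ.IsCycle C) {a b : α} (ha : a ∈ e) (hb : b ∈ e) (hab : a ≠ b) :
    Γ.conn (C.erase e) a b := by
  have hCe : C.erase e ⊆ T := by
    intro g hg
    obtain ⟨hge, hgC⟩ := Finset.mem_erase.1 hg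
    exact (Finset.mem_insert.1 (hCT hgC)).resolve_left hge
  have hpair : ∀ u ∈ e, u = a ∨ u = b := by
    intro u hu
    obtain ⟨x, y, hxy, rfl⟩ := Finset.card_eq_two.1 (Γ.E_card e he)
    simp only [Finset.mem_insert, Finset.mem_singleton] at ha hb hu
    grind
  have hCn := hC.1
  simp only [Acyclic] at hCn
  push Not at hCn
  obtain ⟨g, hg, x, hx, y, hy, hxy, hgc⟩ := hCn
  by_cases hge : g = e
  · subst hge
    rcases hpair x hx with rfl | rfl <;> rcases hpair y hy with rfl | rfl
    · exact absurd rfl hxy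
    · exact hgc
    · exact Setoid.symm' _ hgc
    · exact absurd rfl hxy
  · have hgT : g ∈ T := (Finset.mem_insert.1 (hCT hg)).resolve_left hge
    have hsub : C.erase g ⊆ insert e ((C.erase e).erase g) := by
      intro k hk
      by_cases hke : k = e
      · simp [hke]
      · simp_all
    have hT' : (C.erase e).erase g ⊆ T.erase g :=
      Finset.erase_subset_erase g hCe
    have hgC : g ∈ C.erase e := Finset.mem_erase.2 ⟨hge, hg⟩
    rcases conn_insert (conn_mono hsub hgc) with h | ⟨u, hu, v, hv, h₁, h₂⟩
    · exact absurd (conn_mono hT' h) (hT.acyclic g hgT x hx y hy hxy)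
    · have huv : u ≠ v := by
        rintro rfl
        exact hT.acyclic g hgT x hx y hy hxy (conn_mono hT' (Setoid.trans' _ h₁ h₂))
      have key : Γ.conn (C.erase e) u v :=
        Setoid.trans' _ (Setoid.symm' _ (conn_mono (Finset.erase_subset _ _) h₁))
          (Setoid.trans' _ (conn_edge hgC hx hy)
            (Setoid.symm' _ (conn_mono (Finset.erase_subset _ _) h₂)))
      rcases hpair u hu with rfl | rfl <;> rcases hpair v hv with rfl | rfl
      · exact absurd rfl huv
      · exact key
      · exact Setoid.symm' _ key
      · exact absurd rfl huv

/-- The ends of a non-tree edge are connected through the tree edges of its fundamental cycle. -/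
theorem IsSpanningTree.conn_fundCycle {Γ : HGraph α} {T : Finset (Finset α)}
    (hT : Γ.IsSpanningTree T) {e : Finset α} (he : e ∈ Γ.E) (heT : e ∉ T) {a b : α} (ha : a ∈ e)
    (hb : b ∈ e) : Γ.conn (Γ.fundCycle T e ∩ T) a b := by
  by_cases hab : a = b
  · subst hab; exact Setoid.refl' _ a
  have hTab : Γ.conn T a b := hT.spanning a b (conn_edge he ha hb)
  have hcyc : ¬ Γ.Acyclic (insert e T) := fun h =>
    h e (Finset.mem_insert_self _ _) a ha b hb hab (by rwa [Finset.erase_insert heT])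
  obtain ⟨C, hCT, hC⟩ := exists_isCycle hcyc
  refine conn_mono ?_ (hT.conn_erase he hCT hC ha hb hab)
  intro g hg
  obtain ⟨hge, hgC⟩ := Finset.mem_erase.1 hg
  refine Finset.mem_inter.2 ⟨?_, (Finset.mem_insert.1 (hCT hgC)).resolve_left hge⟩
  simp only [fundCycle, Finset.mem_biUnion, Finset.mem_filter, Finset.mem_powerset, id]
  exact ⟨C, ⟨hCT, hC⟩, hgC⟩

theorem step_of_subgraph {Γ : HGraph α} {X : Finset (Finset α)} (hX : X ⊆ Γ.E)
    {Y : Finset (Finset α)} {a b : α} (h : (Γ.subgraph X hX).Step Y a b) : Γ.Step Y a b := by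
  rcases h with ⟨v, hv, h⟩ | h
  · exact Or.inl ⟨v, (Finset.mem_filter.1 hv).1, h⟩
  · exact Or.inr h

theorem conn_subgraph {Γ : HGraph α} {X : Finset (Finset α)} (hX : X ⊆ Γ.E)
    {Y : Finset (Finset α)} (hY : Y ⊆ X) {a b : α} (h : Γ.conn Y a b) :
    (a ∈ (Γ.subgraph X hX).H ↔ b ∈ (Γ.subgraph X hX).H) ∧
      (a ∈ (Γ.subgraph X hX).H → (Γ.subgraph X hX).conn Y a b) := by
  induction h with
  | rel a b h =>
    rcases h with ⟨v, hv, ha, hb⟩ | ⟨e, he, ha, hb⟩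
    · have key : ∀ c ∈ v, (c ∈ (Γ.subgraph X hX).H ↔ v ∈ Γ.corollas X) := by
        intro c hc
        simp only [subgraph, Finset.mem_sup, id]
        refine ⟨?_, fun h => ⟨v, h, hc⟩⟩
        rintro ⟨w, hw, hcw⟩
        have : w = v := Γ.V.eq_of_mem_parts (Finset.mem_filter.1 hw).1 hv hcw hc
        exact this ▸ hw
      refine ⟨(key a ha).trans (key b hb).symm, fun h => conn_step (Or.inl ⟨v, ?_, ha, hb⟩)⟩
      exact (key a ha).1 h
    · have key : ∀ c ∈ e, c ∈ (Γ.subgraph X hX).H := fun c hc =>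
        (Γ.subgraph X hX).E_sub e (hY he) hc
      exact ⟨iff_of_true (key a ha) (key b hb), fun _ => conn_edge he ha hb⟩
  | refl a => exact ⟨Iff.rfl, fun _ => Setoid.refl' _ a⟩
  | symm a b _ ih => exact ⟨ih.1.symm, fun h => Setoid.symm' _ (ih.2 (ih.1.2 h))⟩
  | trans a b c _ _ h₁ h₂ =>
    exact ⟨h₁.1.trans h₂.1, fun h => Setoid.trans' _ (h₁.2 h) (h₂.2 (h₁.1.1 h))⟩

open Classical in
theorem contract_part {Γ : HGraph α} {X : Finset (Finset α)} (hX : X ⊆ Γ.E) {a b : α} :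
    (∃ v ∈ (Γ.contract X hX).V.parts, a ∈ v ∧ b ∈ v) ↔
      a ∈ (Γ.contract X hX).H ∧ b ∈ (Γ.contract X hX).H ∧ Γ.conn X a b := by
  simp only [contract, Finpartition.ofSetSetoid, Finset.mem_image]
  constructor
  · rintro ⟨_, ⟨c, -, rfl⟩, ha, hb⟩
    obtain ⟨ha, hca⟩ := Finset.mem_filter.1 ha
    obtain ⟨hb, hcb⟩ := Finset.mem_filter.1 hb
    exact ⟨ha, hb, Setoid.trans' _ (Setoid.symm' _ hca) hcb⟩
  · rintro ⟨ha, hb, hab⟩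
    exact ⟨_, ⟨a, ha, rfl⟩, Finset.mem_filter.2 ⟨ha, Setoid.refl' _ a⟩,
      Finset.mem_filter.2 ⟨hb, hab⟩⟩

theorem conn_of_contract {Γ : HGraph α} {X : Finset (Finset α)} (hX : X ⊆ Γ.E)
    {Y : Finset (Finset α)} {a b : α} (h : (Γ.contract X hX).conn Y a b) :
    Γ.conn (X ∪ Y) a b := by
  refine conn_le (fun a b h => ?_) h
  rcases h with h | ⟨e, he, ha, hb⟩
  · exact conn_mono Finset.subset_union_left ((contract_part hX).1 h).2.2
  · exact conn_edge (Finset.mem_union_right _ he) ha hb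

theorem conn_contract {Γ : HGraph α} {X : Finset (Finset α)} (hX : X ⊆ Γ.E)
    {Y : Finset (Finset α)} (hY : Y ⊆ Γ.E \ X) {a b : α} (h : Γ.conn (X ∪ Y) a b)
    (ha : a ∈ (Γ.contract X hX).H) (hb : b ∈ (Γ.contract X hX).H) :
    (Γ.contract X hX).conn Y a b := by
  have key : Γ.conn X a b ∨ ∃ u v, u ∈ (Γ.contract X hX).H ∧ v ∈ (Γ.contract X hX).H ∧
      Γ.conn X a u ∧ (Γ.contract X hX).conn Y u v ∧ Γ.conn X v b := by
    clear ha hb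
    induction h with
    | rel a b h =>
      rcases h with h | ⟨e, he, ha, hb⟩
      · exact Or.inl (conn_step (Or.inl h))
      · rcases Finset.mem_union.1 he with he | he
        · exact Or.inl (conn_edge he ha hb)
        · have hH := (Γ.contract X hX).E_sub e (hY he)
          exact Or.inr ⟨a, b, hH ha, hH hb, Setoid.refl' _ a, conn_edge he ha hb,
            Setoid.refl' _ b⟩
    | refl a => exact Or.inl (Setoid.refl' _ a)
    | symm a b _ ih =>
      rcases ih with h | ⟨u, v, hu, hv, h₁, h₂, h₃⟩
      · exact Or.inl (Setoid.symm' _ h)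
      · exact Or.inr ⟨v, u, hv, hu, Setoid.symm' _ h₃, Setoid.symm' _ h₂, Setoid.symm' _ h₁⟩
    | trans a b c _ _ h₁ h₂ =>
      rcases h₁ with h₁ | ⟨u, v, hu, hv, h₁, h₁', h₁''⟩
      · rcases h₂ with h₂ | ⟨u, v, hu, hv, h₂, h₂', h₂''⟩
        · exact Or.inl (Setoid.trans' _ h₁ h₂)
        · exact Or.inr ⟨u, v, hu, hv, Setoid.trans' _ h₁ h₂, h₂', h₂''⟩
      · rcases h₂ with h₂ | ⟨u', v', hu', hv', h₂, h₂', h₂''⟩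
        · exact Or.inr ⟨u, v, hu, hv, h₁, h₁', Setoid.trans' _ h₁'' h₂⟩
        · refine Or.inr ⟨u, v', hu, hv', h₁, ?_, h₂''⟩
          refine Setoid.trans' _ h₁' (Setoid.trans' _ ?_ h₂')
          exact conn_step (Or.inl ((contract_part hX).2 ⟨hv, hu', Setoid.trans' _ h₁'' h₂⟩))
  have lift : ∀ {c d : α}, c ∈ (Γ.contract X hX).H → d ∈ (Γ.contract X hX).H → Γ.conn X c d →
      (Γ.contract X hX).conn Y c d := fun hc hd h =>
    conn_step (Or.inl ((contract_part hX).2 ⟨hc, hd, h⟩))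
  rcases key with h | ⟨u, v, hu, hv, h₁, h₂, h₃⟩
  · exact lift ha hb h
  · exact Setoid.trans' _ (lift ha hu h₁) (Setoid.trans' _ h₂ (lift hv hb h₃))

/-- If `Z ⊆ X ∩ T` connects the ends of all edges of `X`, then it is a spanning tree of the
subgraph on `X`. -/
theorem IsSpanningTree.subgraph {Γ : HGraph α} {T X Z : Finset (Finset α)}
    (hT : Γ.IsSpanningTree T) (hX : X ⊆ Γ.E) (hZX : Z ⊆ X) (hZT : Z ⊆ T)
    (h : ∀ e ∈ X, ∀ a ∈ e, ∀ b ∈ e, Γ.conn Z a b) : (Γ.subgraph X hX).IsSpanningTree Z where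
  sub := hZX
  acyclic := fun e he a ha b hb hab hc => (hT.acyclic.mono hZT) e he a ha b hb hab
    (conn_le (fun _ _ hs => conn_step (step_of_subgraph hX hs)) hc)
  spanning := fun a b hab => by
    refine conn_of_edges (fun e he c hc d hd => ?_) hab
    exact (conn_subgraph hX hZX (h e he c hc d hd)).2 ((Γ.subgraph X hX).E_sub e he hc)

/-- Under the same hypotheses, with `X ∩ T ⊆ Z`, `T ∖ Z` is a spanning tree of `Γ/X`. -/
theorem IsSpanningTree.contract {Γ : HGraph α} {T X Z : Finset (Finset α)}
    (hT : Γ.IsSpanningTree T) (hX : X ⊆ Γ.E) (hXT : X ∩ T ⊆ Z) (hZT : Z ⊆ T) (hZX : Z ⊆ X)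
    (h : ∀ e ∈ X, ∀ a ∈ e, ∀ b ∈ e, Γ.conn Z a b) :
    (Γ.contract X hX).IsSpanningTree (T \ Z) where
  sub := by
    intro e he
    obtain ⟨he, heZ⟩ := Finset.mem_sdiff.1 he
    exact Finset.mem_sdiff.2 ⟨hT.sub he, fun hx => heZ (hXT (Finset.mem_inter.2 ⟨hx, he⟩))⟩
  acyclic := by
    intro e he a ha b hb hab hc
    obtain ⟨heT, heZ⟩ := Finset.mem_sdiff.1 he
    refine hT.acyclic e heT a ha b hb hab (conn_of_edges ?_ (conn_of_contract hX hc))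
    intro g hg c hc d hd
    rcases Finset.mem_union.1 hg with hg | hg
    · refine conn_mono ?_ (h g hg c hc d hd)
      intro k hk
      exact Finset.mem_erase.2 ⟨fun h => heZ (h ▸ hk), hZT hk⟩
    · refine conn_edge ?_ hc hd
      exact Finset.erase_subset_erase _ Finset.sdiff_subset hg
  spanning := by
    intro a b hab
    have hsub : T \ Z ⊆ Γ.E \ X := by
      intro e he
      obtain ⟨he, heZ⟩ := Finset.mem_sdiff.1 he
      exact Finset.mem_sdiff.2 ⟨hT.sub he, fun hx => heZ (hXT (Finset.mem_inter.2 ⟨hx, he⟩))⟩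
    refine conn_of_edges (fun e he c hc d hd => ?_) hab
    have hH := (Γ.contract X hX).E_sub e he
    refine conn_contract hX hsub ?_ (hH hc) (hH hd)
    refine conn_mono ?_ (hT.spanning c d (conn_edge (Finset.mem_sdiff.1 he).1 hc hd))
    intro g hg
    by_cases hgZ : g ∈ Z
    · exact Finset.mem_union_left _ (hZX hgZ)
    · exact Finset.mem_union_right _ (Finset.mem_sdiff.2 ⟨hg, hgZ⟩)

/-- The empty graph. -/
def empty (α : Type*) [DecidableEq α] : HGraph α where
  H := ∅
  V := Finpartition.empty (Finset α)
  E := ∅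
  E_sub := by simp
  E_card := by simp
  E_disj := by simp

theorem empty_isSpanningTree : (empty α).IsSpanningTree ∅ where
  sub := by simp
  acyclic := by simp [Acyclic]
  spanning := fun _ _ h => h

end HGraph

/-! ## Pairs `(Γ,T)` and `(Γ,F)` -/

/-- A pair `(Γ,T)` of a graph and a spanning tree. -/
structure GT (α : Type*) [DecidableEq α] where
  Γ : HGraph α
  T : Finset (Finset α)
  isTree : Γ.IsSpanningTree T

/-- A pair `(Γ,F)` of a graph and a spanning forest, obtained from a spanning tree `T`, which is
carried along, by removing edges. -/
structure GF (α : Type*) [DecidableEq α] extends GT α where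
  F : Finset (Finset α)
  F_sub : F ⊆ T

namespace GT

/-- `E_L = E_Γ ∖ E_T`. -/
def EL (P : GT α) : Finset (Finset α) := P.Γ.E \ P.T

/-- `l(T,e)`. -/
noncomputable def cycle (P : GT α) (e : Finset α) : Finset (Finset α) := P.Γ.fundCycle P.T e

/-- `t_e = l(T,e) ∩ E_T`. -/
noncomputable def path (P : GT α) (e : Finset α) : Finset (Finset α) := P.cycle e ∩ P.T

/-- The function `f : E_L → 𝒫(E_T)`, `f(e) = t_e`. -/
noncomputable def f (P : GT α) (e : {e // e ∈ P.EL}) : Finset (Finset α) := P.path e.1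

/-- The pair `(Γ,T)` regarded as a pair `(Γ,F)` with `F = T`. -/
def toForest (P : GT α) : GF α := { P with F := P.T, F_sub := subset_rfl }

/-- The unit `𝕀`: the empty graph with its empty spanning tree. -/
def unit (α : Type*) [DecidableEq α] : GT α := ⟨HGraph.empty α, ∅, HGraph.empty_isSpanningTree⟩

end GT

namespace GF

/-- The cut edges `E_T ∖ E_F`. -/
def cut (Q : GF α) : Finset (Finset α) := Q.T \ Q.F

/-- The edges `e ∈ E_L` whose fundamental cycle is left intact: `C_e = t_e ∖ F = ∅`. -/
noncomputable def intactEdges (Q : GF α) : Finset (Finset α) :=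
  Q.EL.filter fun e => Q.path e \ Q.F = ∅

/-- The set `𝖫_F` of intact fundamental cycles. -/
noncomputable def intactCycles (Q : GF α) : Finset (Finset (Finset α)) :=
  Q.intactEdges.image Q.cycle

/-- `t_p`, the union of the tree paths in the cycles of `p`. -/
def treePart (Q : GF α) (p : Finset (Finset (Finset α))) : Finset (Finset α) :=
  p.biUnion fun l => l ∩ Q.T

theorem mem_cycles {Q : GF α} {p : Finset (Finset (Finset α))} (hp : p ⊆ Q.intactCycles)
    {l : Finset (Finset α)} (hl : l ∈ p) :
    ∃ e ∈ Q.Γ.E, e ∉ Q.T ∧ l = Q.Γ.fundCycle Q.T e := by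
  obtain ⟨e, he, rfl⟩ := Finset.mem_image.1 (hp hl)
  obtain ⟨he, -⟩ := Finset.mem_filter.1 he
  obtain ⟨he, heT⟩ := Finset.mem_sdiff.1 he
  exact ⟨e, he, heT, rfl⟩

theorem biUnion_sub {Q : GF α} {p : Finset (Finset (Finset α))} (hp : p ⊆ Q.intactCycles) :
    p.biUnion id ⊆ Q.Γ.E := by
  intro g hg
  obtain ⟨l, hl, hgl⟩ := Finset.mem_biUnion.1 hg
  obtain ⟨e, he, -, rfl⟩ := mem_cycles hp hl
  rcases Finset.mem_insert.1 (Q.Γ.fundCycle_subset Q.T e hgl) with rfl | h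
  · exact he
  · exact Q.isTree.sub h

theorem conn_treePart {Q : GF α} {p : Finset (Finset (Finset α))} (hp : p ⊆ Q.intactCycles) :
    ∀ g ∈ p.biUnion id, ∀ a ∈ g, ∀ b ∈ g, Q.Γ.conn (Q.treePart p) a b := by
  intro g hg a ha b hb
  obtain ⟨l, hl, hgl⟩ := Finset.mem_biUnion.1 hg
  obtain ⟨e, he, heT, rfl⟩ := mem_cycles hp hl
  have hsub : Q.Γ.fundCycle Q.T e ∩ Q.T ⊆ Q.treePart p := fun k hk =>
    Finset.mem_biUnion.2 ⟨_, hl, hk⟩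
  refine HGraph.conn_mono hsub ?_
  rcases Finset.mem_insert.1 (Q.Γ.fundCycle_subset Q.T e hgl) with rfl | h
  · exact Q.isTree.conn_fundCycle he heT ha hb
  · exact HGraph.conn_edge (Finset.mem_inter.2 ⟨hgl, h⟩) ha hb

theorem treePart_sub_tree (Q : GF α) (p : Finset (Finset (Finset α))) : Q.treePart p ⊆ Q.T :=
  Finset.biUnion_subset.2 fun _ _ => Finset.inter_subset_right

theorem treePart_sub_biUnion (Q : GF α) (p : Finset (Finset (Finset α))) :
    Q.treePart p ⊆ p.biUnion id := by
  intro g hg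
  obtain ⟨l, hl, h⟩ := Finset.mem_biUnion.1 hg
  exact Finset.mem_biUnion.2 ⟨l, hl, (Finset.mem_inter.1 h).1⟩

theorem inter_sub_treePart (Q : GF α) (p : Finset (Finset (Finset α))) :
    p.biUnion id ∩ Q.T ⊆ Q.treePart p := by
  intro g hg
  obtain ⟨h, hT⟩ := Finset.mem_inter.1 hg
  obtain ⟨l, hl, h⟩ := Finset.mem_biUnion.1 h
  exact Finset.mem_biUnion.2 ⟨l, hl, Finset.mem_inter.2 ⟨h, hT⟩⟩

/-- The pair `(p,t_p)` for a set `p ⊆ 𝖫_F` of intact cycles. -/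
noncomputable def sub (Q : GF α) (p : Finset (Finset (Finset α))) (hp : p ⊆ Q.intactCycles) :
    GT α where
  Γ := Q.Γ.subgraph (p.biUnion id) (biUnion_sub hp)
  T := Q.treePart p
  isTree := Q.isTree.subgraph (biUnion_sub hp) (Q.treePart_sub_biUnion p) (Q.treePart_sub_tree p)
    (conn_treePart hp)

/-- The pair `(Γ/p,F/t_p)`, carrying along the spanning tree `T/t_p` of `Γ/p`. -/
noncomputable def co (Q : GF α) (p : Finset (Finset (Finset α))) (hp : p ⊆ Q.intactCycles) :
    GF α where
  Γ := Q.Γ.contract (p.biUnion id) (biUnion_sub hp)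
  T := Q.T \ Q.treePart p
  isTree := Q.isTree.contract (biUnion_sub hp) (Q.inter_sub_treePart p) (Q.treePart_sub_tree p)
    (Q.treePart_sub_biUnion p) (conn_treePart hp)
  F := Q.F \ Q.treePart p
  F_sub := Finset.sdiff_subset_sdiff Q.F_sub subset_rfl

end GF

/-- The `ℚ`-vector space spanned by the pairs `(Γ,T)`. -/
abbrev HGT (α : Type*) [DecidableEq α] := GT α →₀ ℚ

/-- The `ℚ`-vector space spanned by the pairs `(Γ,F)`. -/
abbrev HGF (α : Type*) [DecidableEq α] := GF α →₀ ℚ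

/-- The inclusion of the span of the pairs `(Γ,T)` into the span of the pairs `(Γ,F)`. -/
noncomputable def incl : HGT α →ₗ[ℚ] HGF α := Finsupp.lmapDomain ℚ ℚ GT.toForest

/-- `(Γ,F) ↦ 𝕀 ⊗ (Γ,F) + ∑_{∅ ≠ p ⊆ 𝖫_F} (p,t_p) ⊗ (Γ/p,F/t_p)`, extended linearly. -/
noncomputable def ΔGT : HGF α →ₗ[ℚ] HGT α ⊗[ℚ] HGF α :=
  Finsupp.linearCombination ℚ fun Q : GF α =>
    Finsupp.single (GT.unit α) (1 : ℚ) ⊗ₜ[ℚ] Finsupp.single Q (1 : ℚ) +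
      ∑ p ∈ (Q.intactCycles.powerset.erase ∅).attach,
        Finsupp.single (Q.sub p.1 (Finset.mem_powerset.1 (Finset.mem_of_mem_erase p.2))) (1 : ℚ)
          ⊗ₜ[ℚ]
        Finsupp.single (Q.co p.1 (Finset.mem_powerset.1 (Finset.mem_of_mem_erase p.2))) (1 : ℚ)

/-! ## The algebra `𝒜` of symbols `B^{[A₁,A₂]}` -/

variable {L E : Type*} [DecidableEq L] [DecidableEq E]

/-- A symbol `B^{[A₁,A₂]}`: a subset `B` of `E_L` and an interval `[A₁,A₂]` in `𝒫(f(B))`, where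
`f(B) = ⋃_{e ∈ B} f(e)`. -/
@[ext]
structure Sym (f : L → Finset E) where
  B : Finset L
  lo : Finset E
  hi : Finset E
  lo_sub : lo ⊆ hi
  hi_sub : hi ⊆ B.biUnion f

/-- The vector space `𝒜` spanned by the symbols `B^{[A₁,A₂]}`. -/
def Alg (f : L → Finset E) : Type _ := Sym f →₀ ℚ

namespace Alg

set_option linter.unusedSectionVars false

variable {f : L → Finset E}

noncomputable instance : AddCommGroup (Alg f) := inferInstanceAs (AddCommGroup (Sym f →₀ ℚ))

noncomputable instance : Module ℚ (Alg f) := inferInstanceAs (Module ℚ (Sym f →₀ ℚ))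

/-- The basis element of `𝒜` given by a symbol. -/
noncomputable def sym (s : Sym f) : Alg f := Finsupp.single s (1 : ℚ)

/-- Linear maps out of `𝒜` are given by their values on symbols. -/
noncomputable def lift {M : Type*} [AddCommGroup M] [Module ℚ M] (g : Sym f → M) :
    Alg f →ₗ[ℚ] M := Finsupp.linearCombination ℚ g

theorem lift_sym {M : Type*} [AddCommGroup M] [Module ℚ M] (g : Sym f → M) (s : Sym f) :
    lift g (sym s) = g s := (Finsupp.linearCombination_single ℚ 1 s).trans (one_smul ℚ (g s))

theorem hom_ext {M : Type*} [AddCommGroup M] [Module ℚ M] {g h : Alg f →ₗ[ℚ] M}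
    (H : ∀ s, g (sym s) = h (sym s)) : g = h := Finsupp.lhom_ext' fun s =>
  LinearMap.ext_ring (H s)

/-- Compatibility of two symbols: disjoint sets `B₁`, `B₂`, and intervals which agree on
`f(B₁) ∩ f(B₂)`. -/
def Compat (s t : Sym f) : Prop :=
  Disjoint s.B t.B ∧
    s.lo ∩ (s.B.biUnion f ∩ t.B.biUnion f) = t.lo ∩ (s.B.biUnion f ∩ t.B.biUnion f) ∧
    s.hi ∩ (s.B.biUnion f ∩ t.B.biUnion f) = t.hi ∩ (s.B.biUnion f ∩ t.B.biUnion f)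

/-- `(B₁ ∪ B₂)^{[A₁ ∪ A₃, A₂ ∪ A₄]}`. -/
def join (s t : Sym f) : Sym f where
  B := s.B ∪ t.B
  lo := s.lo ∪ t.lo
  hi := s.hi ∪ t.hi
  lo_sub := Finset.union_subset_union s.lo_sub t.lo_sub
  hi_sub := by
    rw [Finset.union_biUnion]
    exact Finset.union_subset_union s.hi_sub t.hi_sub

open Classical in
/-- The product of two symbols. -/
noncomputable def mulSym (s t : Sym f) : Alg f := if Compat s t then sym (join s t) else 0

/-- The product `m` of `𝒜`. -/
noncomputable def mul : Alg f →ₗ[ℚ] Alg f →ₗ[ℚ] Alg f := lift fun s => lift fun t => mulSym s t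

theorem mul_sym (s t : Sym f) : mul (sym s) (sym t) = mulSym s t := by
  rw [mul, lift_sym, lift_sym]

/-- The unit symbol `∅^{[∅,∅]}`. -/
def oneSym : Sym f := ⟨∅, ∅, ∅, subset_rfl, by simp⟩

theorem compat_comm (s t : Sym f) : Compat s t ↔ Compat t s := by
  simp only [Compat, disjoint_comm, Finset.inter_comm (s.B.biUnion f)]
  exact ⟨fun h => ⟨h.1, h.2.1.symm, h.2.2.symm⟩, fun h => ⟨h.1, h.2.1.symm, h.2.2.symm⟩⟩

theorem join_comm (s t : Sym f) : join s t = join t s := by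
  ext1 <;> simp [join, Finset.union_comm]

theorem join_assoc (s t u : Sym f) : join (join s t) u = join s (join t u) := by
  ext1 <;> simp [join, Finset.union_assoc]

theorem compat_join (s t u : Sym f) (h : Compat s t) :
    Compat (join s t) u ↔ Compat s u ∧ Compat t u := by
  obtain ⟨hd, h₁, h₂⟩ := h
  have a₁ := s.lo_sub.trans s.hi_sub
  have a₂ := s.hi_sub
  have b₁ := t.lo_sub.trans t.hi_sub
  have b₂ := t.hi_sub
  simp only [Compat, join, Finset.union_biUnion, Finset.disjoint_union_left]
  generalize s.B.biUnion f = S at *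
  generalize t.B.biUnion f = T at *
  generalize u.B.biUnion f = U at *
  have aux : ∀ {X Y Z : Finset E}, X ⊆ S → Y ⊆ T → X ∩ (S ∩ T) = Y ∩ (S ∩ T) →
      ((X ∪ Y) ∩ ((S ∪ T) ∩ U) = Z ∩ ((S ∪ T) ∩ U) ↔
        X ∩ (S ∩ U) = Z ∩ (S ∩ U) ∧ Y ∩ (T ∩ U) = Z ∩ (T ∩ U)) := by
    intro X Y Z hX hY hXY
    simp only [Finset.ext_iff, Finset.mem_inter, Finset.mem_union, Finset.subset_iff] at *
    constructor
    · intro h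
      exact ⟨fun x => by grind, fun x => by grind⟩
    · rintro ⟨h, h'⟩ x
      grind
  rw [aux a₁ b₁ h₁, aux a₂ b₂ h₂]
  tauto

theorem mulSym_comm (s t : Sym f) : mulSym s t = mulSym t s := by
  by_cases h : Compat s t
  · rw [mulSym, mulSym, if_pos h, if_pos ((compat_comm s t).1 h), join_comm]
  · rw [mulSym, mulSym, if_neg h, if_neg fun h' => h ((compat_comm s t).2 h')]

theorem mulSym_assoc (s t u : Sym f) :
    mul (mulSym s t) (sym u) = mul (sym s) (mulSym t u) := by
  by_cases hst : Compat s t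
  · by_cases htu : Compat t u
    · have h₁ := compat_join s t u hst
      have h₂ := compat_join t u s htu
      rw [compat_comm (join t u) s, compat_comm t s, compat_comm u s] at h₂
      simp only [mulSym, if_pos hst, if_pos htu, mul_sym, join_assoc]
      congr 1
      rw [h₁, h₂]
      exact propext ⟨fun h => ⟨hst, h.1⟩, fun h => ⟨h.2, htu⟩⟩
    · have h₁ : ¬ Compat (join s t) u := fun h => htu ((compat_join s t u hst).1 h).2
      simp only [mulSym, if_pos hst, if_neg htu, mul_sym, if_neg h₁, map_zero]
  · by_cases htu : Compat t u
    · have h₁ : ¬ Compat s (join t u) := fun h =>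
        hst ((compat_comm t s).1 ((compat_join t u s htu).1 ((compat_comm _ _).1 h)).1)
      simp only [mulSym, if_neg hst, if_pos htu, mul_sym, if_neg h₁, map_zero,
        LinearMap.zero_apply]
    · simp only [mulSym, if_neg hst, if_neg htu, map_zero, LinearMap.zero_apply]

theorem one_mulSym (s : Sym f) : mulSym oneSym s = sym s := by
  have h : Compat oneSym s := by simp [Compat, oneSym]
  have h' : join oneSym s = s := by ext1 <;> simp [join, oneSym]
  rw [mulSym, if_pos h, h']

theorem mul_comm' (a b : Alg f) : mul a b = mul b a := by
  have : (mul : Alg f →ₗ[ℚ] Alg f →ₗ[ℚ] Alg f) = mul.flip :=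
    hom_ext fun s => hom_ext fun t => by
      rw [LinearMap.flip_apply, mul_sym, mul_sym, mulSym_comm]
  conv_lhs => rw [this]
  rfl

theorem one_mul' (a : Alg f) : mul (sym oneSym) a = a := by
  have : mul (sym (oneSym : Sym f)) = LinearMap.id :=
    hom_ext fun s => by rw [mul_sym, one_mulSym, LinearMap.id_apply]
  rw [this, LinearMap.id_apply]

theorem mul_assoc' (a b c : Alg f) : mul (mul a b) c = mul a (mul b c) := by
  have h₁ : ∀ s t : Sym f, mul (mul (sym s) (sym t)) = (mul (sym s)).comp (mul (sym t)) :=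
    fun s t => hom_ext fun u => by
      rw [LinearMap.comp_apply, mul_sym, mul_sym, mulSym_assoc]
  have h₂ : ∀ s : Sym f, ∀ b c : Alg f,
      mul (mul (sym s) b) c = mul (sym s) (mul b c) := by
    intro s b c
    have : mul.comp (mul (sym s)) = (LinearMap.llcomp ℚ (Alg f) (Alg f) (Alg f) (mul (sym s))).comp
        mul := hom_ext fun t => h₁ s t
    exact congrArg (fun g : Alg f →ₗ[ℚ] Alg f →ₗ[ℚ] Alg f => g b c) this
  have : (mul.flip c).comp (mul.flip b) = mul.flip (mul b c) := hom_ext fun s => h₂ s b c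
  exact congrArg (fun g : Alg f →ₗ[ℚ] Alg f => g a) this

/-- The commutative algebra structure `(𝒜, m, ∅^{[∅,∅]})`. -/
noncomputable instance : CommRing (Alg f) :=
  { (inferInstance : AddCommGroup (Alg f)) with
    mul := fun a b => mul a b
    one := sym oneSym
    mul_assoc := mul_assoc'
    mul_comm := mul_comm'
    one_mul := one_mul'
    mul_one := fun a => (mul_comm' _ _).trans (one_mul' a)
    left_distrib := fun a b c => map_add (mul a) b c
    right_distrib := fun a b c => by
      change mul (a + b) c = mul a c + mul b c
      rw [map_add, LinearMap.add_apply]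
    zero_mul := fun a => by
      change mul 0 a = 0
      rw [map_zero, LinearMap.zero_apply]
    mul_zero := fun a => map_zero (mul a) }

/-- The generator `x_{e,[A₁,A₂]}`: the symbol with `B = {e}` and the interval `[A₁,A₂]` restricted
to `f(e)`. -/
noncomputable def x (f : L → Finset E) (e : L) (A₁ A₂ : Finset E) (h : A₁ ⊆ A₂) : Alg f :=
  sym ⟨{e}, A₁ ∩ f e, A₂ ∩ f e, Finset.inter_subset_inter_right h, by simp⟩

/-- The symbol `C^{[A₁ ∩ f(C), A₂ ∩ f(C)]}`. -/
def restrict (s : Sym f) (C : Finset L) : Sym f where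
  B := C
  lo := s.lo ∩ C.biUnion f
  hi := s.hi ∩ C.biUnion f
  lo_sub := Finset.inter_subset_inter_right s.lo_sub
  hi_sub := Finset.inter_subset_right

/-- `Δ_c(B^{[A₁,A₂]})`, the sum over `B₁ ⊆ B` with `f(B₁) ∩ A₁ = ∅` of
`B₁^{[A₁ ∩ f(B₁), A₂ ∩ f(B₁)]} ⊗ (B∖B₁)^{[A₁ ∩ f(B∖B₁), A₂ ∩ f(B∖B₁)]}`. -/
noncomputable def Δc : Alg f →ₗ[ℚ] Alg f ⊗[ℚ] Alg f :=
  lift fun s => ∑ B₁ ∈ s.B.powerset with B₁.biUnion f ∩ s.lo = ∅,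
    sym (restrict s B₁) ⊗ₜ[ℚ] sym (restrict s (s.B \ B₁))

end Alg

/-! ## The map `w` relative to a fixed parent pair `(Γ,T)` -/

/-- A pair `Q` is built from edges of the parent `P = (Γ,T)`: its tree edges are tree edges of `P`,
and its non-tree edges are non-tree edges of `P`. -/
def GF.LivesIn (Q : GF α) (P : GT α) : Prop := Q.T ⊆ P.T ∧ Q.EL ⊆ P.EL

theorem GF.LivesIn.cut_sub {Q : GF α} {P : GT α} (h : Q.LivesIn P) : Q.cut ⊆ P.T :=
  Finset.sdiff_subset.trans h.1

open Classical in
/-- `B^{[E_T'∖E_F', E_T]}` (interval restricted to `f(B)`) with `B = E_L'`, in the algebra `𝒜` of the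
fixed parent `P = (Γ,T)`, for a pair `Q = (Γ',F')` with tree `T'` and non-tree edges `E_L'` that is
built from edges of the parent; zero on all other pairs. -/
noncomputable def symbolOf (P : GT α) (Q : GF α) : Alg P.f :=
  if h : Q.LivesIn P then
    let B := Q.EL.subtype (fun e => e ∈ P.EL)
    Alg.sym ⟨B, Q.cut ∩ B.biUnion P.f, P.T ∩ B.biUnion P.f,
      Finset.inter_subset_inter_right h.cut_sub, Finset.inter_subset_right⟩
  else 0

open Classical in
/-- The monomial `∏ x_{e,[E_T'∖E_F', E_T]}` over the edges `e` whose fundamental cycle in `Q` is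
intact, in the algebra `𝒜` of the fixed parent `P = (Γ,T)`, for a pair `Q = (Γ',F')` with tree `T'`
that is built from edges of the parent; zero on all other pairs. -/
noncomputable def monomialOf (P : GT α) (Q : GF α) : Alg P.f :=
  if h : Q.LivesIn P then
    ∏ e ∈ Q.intactEdges.subtype (fun e => e ∈ P.EL), Alg.x P.f e Q.cut P.T h.cut_sub
  else 0

/-- The map `w : (Γ',F') ↦ ∏ x_{e,[E_T'∖E_F', E_T]}`, product over intact fundamental cycles. -/
noncomputable def w (P : GT α) : HGF α →ₗ[ℚ] Alg P.f :=
  Finsupp.linearCombination ℚ (monomialOf P)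

/-- The map `(Γ',F') ↦ E_L'^{[E_T'∖E_F', E_T]}`, involving all fundamental cycles. -/
noncomputable def wSymbol (P : GT α) : HGF α →ₗ[ℚ] Alg P.f :=
  Finsupp.linearCombination ℚ (symbolOf P)

end CutGraphs

/-! Write `I` for the set of intact edges of `Q = (Γ,F)`. Relative to the parent `(Γ,T)`, both maps
send `Q` to a single symbol with interval `[cut ∩ f(B), T ∩ f(B)]`: `B` is all of `E_L` for
`wSymbol`, and `B = I` for `w`, because generators with a common interval are always compatible and
multiply to one symbol (`prod_x`).

In `Δc` of such a symbol the condition `f(B₁) ∩ A₁ = ∅` says that no tree path of `B₁` meets a cut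
edge, so the sum runs over all `C ⊆ I` (`biUnion_f_inter_cut`). In `ΔGT` the sum runs over sets `p`
of intact cycles, and these are also the subsets of `I`, since an edge `e` is the only non-tree edge
of its cycle (`cycle_injOn`). The term `C = ∅` is the one with `𝕀` on the left.

The remaining terms agree factor by factor. The pair `(p,t_p)` has non-tree edges `C` and no cuts,
matching the empty lower end on the left. The pair `(Γ/p,F/t_p)` has non-tree edges `E_L ∖ C` and
the same cut edges as `Q`, because `t_p ⊆ F`.

For `w` one also needs that the intact edges of the quotient are `I ∖ C` (`co_intactEdges`). This is
the graph-theoretic core: an edge is intact exactly when `F` connects its ends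
(`fundCycle_inter_subset_iff`), and contracting edges whose ends `F` already connects does not
affect this. -/

namespace CutGraphs

/-! ### Fundamental cycles and connectivity through subforests. -/

namespace HGraph

/-- The edge `e` lies in every cycle of `T ∪ {e}`. -/
theorem IsSpanningTree.mem_cycle {α : Type*} [DecidableEq α] {Γ : HGraph α}
    {T C : Finset (Finset α)} (hT : Γ.IsSpanningTree T) {e : Finset α} (hCT : C ⊆ insert e T)
    (hC : Γ.IsCycle C) : e ∈ C := by
  by_contra he
  refine hC.1 (hT.acyclic.mono fun g hg => (Finset.mem_insert.1 (hCT hg)).resolve_left ?_)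
  rintro rfl
  exact he hg

theorem IsSpanningTree.mem_fundCycle {α : Type*} [DecidableEq α] {Γ : HGraph α}
    {T : Finset (Finset α)} (hT : Γ.IsSpanningTree T) {e : Finset α} (he : e ∈ Γ.E)
    (heT : e ∉ T) : e ∈ Γ.fundCycle T e := by
  obtain ⟨a, b, hab, rfl⟩ := Finset.card_eq_two.1 (Γ.E_card e he)
  have hcyc : ¬ Γ.Acyclic (insert {a, b} T) := fun h =>
    h {a, b} (Finset.mem_insert_self _ _) a (by simp) b (by simp) hab
      (by rw [Finset.erase_insert heT]
          exact hT.spanning a b (conn_edge he (by simp) (by simp)))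
  obtain ⟨C, hCT, hC⟩ := exists_isCycle hcyc
  simp only [fundCycle, Finset.mem_biUnion, Finset.mem_filter, Finset.mem_powerset, id]
  exact ⟨C, ⟨hCT, hC⟩, hT.mem_cycle hCT hC⟩

/-- A subset `F` of the tree connects the ends of a non-tree edge if and only if it contains the
tree edges of the fundamental cycle. -/
theorem IsSpanningTree.fundCycle_inter_subset_iff {α : Type*} [DecidableEq α] {Γ : HGraph α}
    {T F : Finset (Finset α)} (hT : Γ.IsSpanningTree T) (hF : F ⊆ T) {e : Finset α}
    (he : e ∈ Γ.E) (heT : e ∉ T) :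
    Γ.fundCycle T e ∩ T ⊆ F ↔ ∀ a ∈ e, ∀ b ∈ e, Γ.conn F a b := by
  refine ⟨fun h a ha b hb => conn_mono h (hT.conn_fundCycle he heT ha hb), fun h g hg => ?_⟩
  obtain ⟨hg, hgT⟩ := Finset.mem_inter.1 hg
  simp only [fundCycle, Finset.mem_biUnion, Finset.mem_filter, Finset.mem_powerset, id] at hg
  obtain ⟨C, ⟨hCT, hC⟩, hgC⟩ := hg
  have heC := hT.mem_cycle hCT hC
  have hge : g ≠ e := by rintro rfl; exact heT hgT
  by_contra hgF
  obtain ⟨a, b, hab, hpair⟩ := Finset.card_eq_two.1 (Γ.E_card e he)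
  have ha : a ∈ e := by simp [hpair]
  have hb : b ∈ e := by simp [hpair]
  -- Minimality of `C`: removing `g` leaves an acyclic set, in which `e` is a bridge.
  have hcut : ∀ c ∈ e, ∀ d ∈ e, c ≠ d → ¬ Γ.conn ((C.erase g).erase e) c d :=
    hC.2 _ (Finset.erase_ssubset hgC) e (Finset.mem_erase.2 ⟨hge.symm, heC⟩)
  have hsub : (C.erase g).erase e ⊆ T.erase g := by
    intro k hk
    simp only [Finset.mem_erase] at hk ⊢
    exact ⟨hk.2.1, (Finset.mem_insert.1 (hCT hk.2.2)).resolve_left hk.1⟩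
  have hins : C.erase e ⊆ insert g ((C.erase g).erase e) := by
    intro k hk
    simp only [Finset.mem_erase, Finset.mem_insert] at hk ⊢
    tauto
  have hFsub : F ⊆ T.erase g := fun k hk =>
    Finset.mem_erase.2 ⟨fun h => hgF (h ▸ hk), hF hk⟩
  -- The rest of the cycle joins the ends of `e`, and without `g` it does not, so it must pass
  -- through `g`. If `F` avoids `g`, then going from one end of `g` along the cycle to `e`, across
  -- through `F`, and back along the cycle joins the two ends of `g` inside `T ∖ {g}`, although `g`
  -- is a bridge of `T`.
  rcases conn_insert (conn_mono hins (hT.conn_erase he hCT hC ha hb hab)) with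
    h' | ⟨u, hu, v, hv, h₁, h₂⟩
  · exact hcut a ha b hb hab h'
  · have huv : u ≠ v := by
      rintro rfl
      exact hcut a ha b hb hab (Setoid.trans' _ h₁ h₂)
    exact hT.acyclic g hgT u hu v hv huv (Setoid.trans' _ (Setoid.symm' _ (conn_mono hsub h₁))
      (Setoid.trans' _ (conn_mono hFsub (h a ha b hb)) (Setoid.symm' _ (conn_mono hsub h₂))))

end HGraph

/-! ### The cycle of a non-tree edge determines the edge. -/

namespace GT

theorem path_subset {α : Type*} [DecidableEq α] (P : GT α) (e : Finset α) : P.path e ⊆ P.T :=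
  Finset.inter_subset_right

theorem mem_EL {α : Type*} [DecidableEq α] {P : GT α} {e : Finset α} :
    e ∈ P.EL ↔ e ∈ P.Γ.E ∧ e ∉ P.T := Finset.mem_sdiff

theorem cycle_eq {α : Type*} [DecidableEq α] {P : GT α} {e : Finset α} (he : e ∈ P.EL) :
    P.cycle e = insert e (P.path e) := by
  have h := P.Γ.fundCycle_subset P.T e
  have h' := P.isTree.mem_fundCycle (mem_EL.1 he).1 (mem_EL.1 he).2
  ext g
  simp only [path, cycle, Finset.mem_insert, Finset.mem_inter]
  constructor
  · intro hg
    rcases Finset.mem_insert.1 (h hg) with h | h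
    · exact Or.inl h
    · exact Or.inr ⟨hg, h⟩
  · rintro (rfl | h)
    · exact h'
    · exact h.1

/-- Apart from `e` itself the cycle of `e` lies in the tree, so `e` can be read off as its only
non-tree edge. Sets of cycles and sets of edges thereby become interchangeable. -/
theorem cycle_injOn {α : Type*} [DecidableEq α] (P : GT α) :
    Set.InjOn P.cycle (P.EL : Set (Finset α)) := by
  intro e he e' he' h
  rw [cycle_eq he, cycle_eq he'] at h
  have : e ∈ insert e' (P.path e') := h ▸ Finset.mem_insert_self _ _
  exact (Finset.mem_insert.1 this).resolve_right fun h' =>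
    (mem_EL.1 he).2 (P.path_subset e' h')

end GT

/-! ### Non-tree, cut and intact edges of sub-pairs and quotient pairs. -/

namespace GF

theorem mem_intactEdges {α : Type*} [DecidableEq α] {Q : GF α} {e : Finset α} :
    e ∈ Q.intactEdges ↔ e ∈ Q.EL ∧ Q.path e ⊆ Q.F := by
  rw [intactEdges, Finset.mem_filter, Finset.sdiff_eq_empty_iff_subset]

theorem intactEdges_subset {α : Type*} [DecidableEq α] (Q : GF α) : Q.intactEdges ⊆ Q.EL :=
  Finset.filter_subset _ _

/-- Connectivity passes to contractions directly, so with this form of intactness the fundamental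
cycles of `Γ/p` never have to be computed. -/
theorem mem_intactEdges_iff_conn {α : Type*} [DecidableEq α] {Q : GF α} {e : Finset α} :
    e ∈ Q.intactEdges ↔ e ∈ Q.EL ∧ ∀ a ∈ e, ∀ b ∈ e, Q.Γ.conn Q.F a b := by
  rw [mem_intactEdges]
  refine and_congr_right fun he => ?_
  exact Q.isTree.fundCycle_inter_subset_iff Q.F_sub (GT.mem_EL.1 he).1 (GT.mem_EL.1 he).2

theorem image_cycle_subset {α : Type*} [DecidableEq α] {Q : GF α} {C : Finset (Finset α)}
    (hC : C ⊆ Q.intactEdges) : C.image Q.cycle ⊆ Q.intactCycles :=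
  Finset.image_subset_image hC

theorem treePart_image {α : Type*} [DecidableEq α] (Q : GF α) (C : Finset (Finset α)) :
    Q.treePart (C.image Q.cycle) = C.biUnion Q.path := by
  rw [treePart, Finset.image_biUnion]
  rfl

theorem treePart_image_subset {α : Type*} [DecidableEq α] {Q : GF α} {C : Finset (Finset α)}
    (hC : C ⊆ Q.intactEdges) : Q.treePart (C.image Q.cycle) ⊆ Q.F := by
  rw [treePart_image]
  exact Finset.biUnion_subset.2 fun e he => (mem_intactEdges.1 (hC he)).2

theorem biUnion_image_cycle {α : Type*} [DecidableEq α] {Q : GF α} {C : Finset (Finset α)}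
    (hC : C ⊆ Q.intactEdges) :
    (C.image Q.cycle).biUnion id = C ∪ C.biUnion Q.path := by
  ext g
  simp only [Finset.image_biUnion, id, Finset.mem_biUnion, Finset.mem_union]
  constructor
  · rintro ⟨e, he, hg⟩
    rw [GT.cycle_eq (Q.intactEdges_subset (hC he))] at hg
    rcases Finset.mem_insert.1 hg with rfl | hg
    · exact Or.inl he
    · exact Or.inr ⟨e, he, hg⟩
  · rintro (h | ⟨e, he, hg⟩)
    · refine ⟨g, h, ?_⟩
      rw [GT.cycle_eq (Q.intactEdges_subset (hC h))]
      exact Finset.mem_insert_self _ _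
    · exact ⟨e, he, (Finset.mem_inter.1 hg).1⟩

theorem notMem_tree {α : Type*} [DecidableEq α] {Q : GF α} {C : Finset (Finset α)}
    (hC : C ⊆ Q.intactEdges) {e : Finset α} (he : e ∈ C) : e ∉ Q.T :=
  (GT.mem_EL.1 (Q.intactEdges_subset (hC he))).2

theorem sub_EL {α : Type*} [DecidableEq α] {Q : GF α} {C : Finset (Finset α)}
    (hC : C ⊆ Q.intactEdges) :
    (Q.sub (C.image Q.cycle) (image_cycle_subset hC)).EL = C := by
  change (C.image Q.cycle).biUnion id \ Q.treePart (C.image Q.cycle) = C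
  rw [biUnion_image_cycle hC, treePart_image, Finset.union_sdiff_right]
  refine Finset.sdiff_eq_self_of_disjoint (Finset.disjoint_left.2 fun e he h => ?_)
  obtain ⟨e', -, h⟩ := Finset.mem_biUnion.1 h
  exact notMem_tree hC he (Q.path_subset _ h)

theorem co_EL {α : Type*} [DecidableEq α] {Q : GF α} {C : Finset (Finset α)}
    (hC : C ⊆ Q.intactEdges) :
    (Q.co (C.image Q.cycle) (image_cycle_subset hC)).EL = Q.EL \ C := by
  change (Q.Γ.E \ (C.image Q.cycle).biUnion id) \ (Q.T \ Q.treePart (C.image Q.cycle)) =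
    (Q.Γ.E \ Q.T) \ C
  have h := Q.treePart_sub_tree (C.image Q.cycle)
  rw [biUnion_image_cycle hC, ← treePart_image]
  ext e
  have h₁ := @h e
  simp only [Finset.mem_sdiff, Finset.mem_union]
  tauto

/-- Intactness of `C` puts `t_p` inside `F`, so the contraction removes only uncut tree edges. -/
theorem co_cut {α : Type*} [DecidableEq α] {Q : GF α} {C : Finset (Finset α)}
    (hC : C ⊆ Q.intactEdges) :
    (Q.co (C.image Q.cycle) (image_cycle_subset hC)).cut = Q.cut := by
  change (Q.T \ Q.treePart (C.image Q.cycle)) \ (Q.F \ Q.treePart (C.image Q.cycle)) = Q.T \ Q.F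
  ext e
  have h₁ : e ∈ Q.treePart (C.image Q.cycle) → e ∈ Q.F := fun h => treePart_image_subset hC h
  simp only [Finset.mem_sdiff]
  tauto

/-- The contracted edges have ends connected through `t_p ⊆ F`, so `F ∖ t_p` connects two surviving
half-edges in the quotient exactly when `F` connects them in `Γ`. -/
theorem co_intactEdges {α : Type*} [DecidableEq α] {Q : GF α} {C : Finset (Finset α)}
    (hC : C ⊆ Q.intactEdges) :
    (Q.co (C.image Q.cycle) (image_cycle_subset hC)).intactEdges = Q.intactEdges \ C := by
  have hp := image_cycle_subset hC
  ext e
  rw [mem_intactEdges_iff_conn, co_EL hC, Finset.mem_sdiff, Finset.mem_sdiff,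
    mem_intactEdges_iff_conn, and_right_comm]
  refine and_congr_left fun heC => and_congr_right fun he => forall₂_congr fun a ha =>
    forall₂_congr fun b hb => ?_
  -- Contraction deletes half-edges, and `conn_contract` speaks only of those that survive; the
  -- halves of `e` do, as `e` is not in `C`.
  have heH : e ⊆ (Q.co (C.image Q.cycle) hp).Γ.H := by
    have : e ∈ (Q.co (C.image Q.cycle) hp).EL := by
      rw [co_EL hC]
      exact Finset.mem_sdiff.2 ⟨he, heC⟩
    exact HGraph.E_sub _ e (GT.mem_EL.1 this).1
  constructor
  · intro h
    refine HGraph.conn_of_edges (fun g hg c hc d hd => ?_)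
      (HGraph.conn_of_contract (biUnion_sub hp) h)
    rcases Finset.mem_union.1 hg with hg | hg
    · exact HGraph.conn_mono (treePart_image_subset hC) (conn_treePart hp g hg c hc d hd)
    · exact HGraph.conn_edge (Finset.mem_sdiff.1 hg).1 hc hd
  · intro h
    refine HGraph.conn_contract (biUnion_sub hp) ?_ (HGraph.conn_mono ?_ h) (heH ha) (heH hb)
    · exact ((Q.co _ hp).F_sub).trans (Q.co _ hp).isTree.sub
    · intro g hg
      by_cases hgp : g ∈ Q.treePart (C.image Q.cycle)
      · exact Finset.mem_union_left _ (Q.treePart_sub_biUnion _ hgp)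
      · exact Finset.mem_union_right _ (Finset.mem_sdiff.2 ⟨hg, hgp⟩)

theorem toForest_intactEdges {α : Type*} [DecidableEq α] (P : GT α) :
    P.toForest.intactEdges = P.EL := by
  ext e
  rw [mem_intactEdges]
  exact and_iff_left (P.path_subset e)

theorem toForest_cut {α : Type*} [DecidableEq α] (P : GT α) : P.toForest.cut = ∅ :=
  Finset.sdiff_self _

end GF

/-! ### Products of generators and restrictions of symbols. -/

namespace Alg

theorem sym_mul_sym {L E : Type*} [DecidableEq L] [DecidableEq E] {f : L → Finset E}
    (s t : Sym f) : sym s * sym t = mulSym s t := mul_sym s t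

/-- A product of generators with a common interval is a single symbol. -/
theorem prod_x {L E : Type*} [DecidableEq L] [DecidableEq E] (f : L → Finset E) (B : Finset L)
    (A₁ A₂ : Finset E) (h : A₁ ⊆ A₂) :
    ∏ e ∈ B, x f e A₁ A₂ h = sym ⟨B, A₁ ∩ B.biUnion f, A₂ ∩ B.biUnion f,
      Finset.inter_subset_inter_right h, Finset.inter_subset_right⟩ := by
  induction B using Finset.induction_on with
  | empty =>
    rw [Finset.prod_empty]
    change sym oneSym = _
    congr 1
    ext1 <;> simp [oneSym]
  | insert e B he ih =>
    rw [Finset.prod_insert he, ih, x, sym_mul_sym, mulSym, if_pos]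
    · congr 1
      ext1
      · rfl
      · simp [join, Finset.inter_union_distrib_left]
      · simp [join, Finset.inter_union_distrib_left]
    -- Both factors carry traces of the same `A₁` and `A₂`, so they agree wherever their supports
    -- overlap.
    · refine ⟨by simpa using he, ?_, ?_⟩ <;>
      · ext g
        simp only [Finset.mem_inter, Finset.singleton_biUnion]
        tauto

theorem restrict_empty {L E : Type*} [DecidableEq L] [DecidableEq E] {f : L → Finset E}
    (s : Sym f) : restrict s ∅ = oneSym := by
  ext1 <;> simp [restrict, oneSym]

theorem restrict_self {L E : Type*} [DecidableEq L] [DecidableEq E] {f : L → Finset E}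
    (s : Sym f) : restrict s s.B = s := by
  ext1
  · rfl
  · exact Finset.inter_eq_left.2 (s.lo_sub.trans s.hi_sub)
  · exact Finset.inter_eq_left.2 s.hi_sub

/-- Since `f(C) ⊆ f(B)`, the trace of `A` on `f(C)` is unchanged by first truncating `A` to `f(B)`.
This brings restricted symbols into the shape in which `symbolOf` and `monomialOf` are defined. -/
theorem restrict_lo {L E : Type*} [DecidableEq L] [DecidableEq E] {f : L → Finset E}
    {s : Sym f} {A : Finset E} (h : s.lo = A ∩ s.B.biUnion f) {C : Finset L} (hC : C ⊆ s.B) :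
    (restrict s C).lo = A ∩ C.biUnion f := by
  change s.lo ∩ C.biUnion f = _
  rw [h, Finset.inter_assoc,
    Finset.inter_eq_right.2 (Finset.biUnion_subset_biUnion_of_subset_left _ hC)]

theorem restrict_hi {L E : Type*} [DecidableEq L] [DecidableEq E] {f : L → Finset E}
    {s : Sym f} {A : Finset E} (h : s.hi = A ∩ s.B.biUnion f) {C : Finset L} (hC : C ⊆ s.B) :
    (restrict s C).hi = A ∩ C.biUnion f := by
  change s.hi ∩ C.biUnion f = _
  rw [h, Finset.inter_assoc,
    Finset.inter_eq_right.2 (Finset.biUnion_subset_biUnion_of_subset_left _ hC)]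

end Alg

/-! ### The values of the two maps as single symbols. -/

theorem symbolOf_eq {α : Type*} [DecidableEq α] {P : GT α} {Q : GF α} (h : Q.LivesIn P)
    {s : Sym P.f} (hB : ∀ e, e ∈ s.B ↔ e.1 ∈ Q.EL) (hlo : s.lo = Q.cut ∩ s.B.biUnion P.f)
    (hhi : s.hi = P.T ∩ s.B.biUnion P.f) : symbolOf P Q = Alg.sym s := by
  classical
  have hB' : Q.EL.subtype (fun e => e ∈ P.EL) = s.B := by
    ext e
    rw [Finset.mem_subtype, hB]
  rw [symbolOf, dif_pos h]
  refine congrArg Alg.sym (Sym.ext ?_ ?_ ?_)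
  · exact hB'
  · simp only [hB', hlo]
  · simp only [hB', hhi]

/-- By `prod_x` the monomial collapses to a symbol, so the two maps differ only in the choice of
`B`. -/
theorem monomialOf_eq {α : Type*} [DecidableEq α] {P : GT α} {Q : GF α} (h : Q.LivesIn P)
    {s : Sym P.f} (hB : ∀ e, e ∈ s.B ↔ e.1 ∈ Q.intactEdges)
    (hlo : s.lo = Q.cut ∩ s.B.biUnion P.f)
    (hhi : s.hi = P.T ∩ s.B.biUnion P.f) : monomialOf P Q = Alg.sym s := by
  classical
  have hB' : Q.intactEdges.subtype (fun e => e ∈ P.EL) = s.B := by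
    ext e
    rw [Finset.mem_subtype, hB]
  rw [monomialOf, dif_pos h, Alg.prod_x]
  refine congrArg Alg.sym (Sym.ext ?_ ?_ ?_)
  · exact hB'
  · simp only [hB', hlo]
  · simp only [hB', hhi]

/-! ### Living in the parent, and the summation condition of `Δc`. -/

namespace GF

theorem image_val_subset {α : Type*} [DecidableEq α] {P : GT α} {I : Finset (Finset α)}
    {C : Finset {e // e ∈ P.EL}} (hC : C ⊆ I.subtype (fun e => e ∈ P.EL)) :
    C.image Subtype.val ⊆ I := by
  intro e he
  obtain ⟨e', he', rfl⟩ := Finset.mem_image.1 he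
  exact Finset.mem_subtype.1 (hC he')

theorem mem_image_val {α : Type*} [DecidableEq α] {P : GT α}
    {C : Finset {e // e ∈ P.EL}} {e : {e // e ∈ P.EL}} :
    e.1 ∈ C.image Subtype.val ↔ e ∈ C :=
  Finset.mem_image.trans ⟨fun ⟨_, h, h'⟩ => Subtype.ext h' ▸ h, fun h => ⟨e, h, rfl⟩⟩

theorem sub_livesIn {α : Type*} [DecidableEq α] {Q : GF α} {C : Finset (Finset α)}
    (hC : C ⊆ Q.intactEdges) :
    (Q.sub (C.image Q.cycle) (image_cycle_subset hC)).toForest.LivesIn Q.toGT := by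
  refine ⟨Q.treePart_sub_tree _, ?_⟩
  change (Q.sub (C.image Q.cycle) (image_cycle_subset hC)).EL ⊆ _
  rw [sub_EL hC]
  exact hC.trans Q.intactEdges_subset

theorem co_livesIn {α : Type*} [DecidableEq α] {Q : GF α} {C : Finset (Finset α)}
    (hC : C ⊆ Q.intactEdges) :
    (Q.co (C.image Q.cycle) (image_cycle_subset hC)).LivesIn Q.toGT := by
  refine ⟨Finset.sdiff_subset, ?_⟩
  rw [co_EL hC]
  exact Finset.sdiff_subset

theorem unit_livesIn {α : Type*} [DecidableEq α] (P : GT α) : (GT.unit α).toForest.LivesIn P :=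
  ⟨Finset.empty_subset _, (Finset.sdiff_subset).trans (Finset.empty_subset _)⟩

/-- Tree paths lie in `T`, so avoiding `T ∖ F` is the same as lying in `F`. -/
theorem biUnion_f_inter_cut {α : Type*} [DecidableEq α] {Q : GF α}
    {C : Finset {e // e ∈ Q.EL}} :
    C.biUnion Q.f ∩ Q.cut = ∅ ↔ C ⊆ Q.intactEdges.subtype (fun e => e ∈ Q.EL) := by
  rw [← Finset.disjoint_iff_inter_eq_empty, Finset.disjoint_biUnion_left]
  refine forall₂_congr fun e _ => ?_
  rw [Finset.mem_subtype, mem_intactEdges, and_iff_right e.2, Finset.disjoint_left]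
  refine forall₂_congr fun g hg => ?_
  simp only [cut, Finset.mem_sdiff, Q.path_subset _ hg, true_and, not_not]

theorem subset_and_biUnion_f_inter_cut {α : Type*} [DecidableEq α] {Q : GF α}
    {B C : Finset {e // e ∈ Q.EL}} (hCB : C ⊆ B) :
    C ⊆ B ∧ C.biUnion Q.f ∩ (Q.cut ∩ B.biUnion Q.f) = ∅ ↔
      C ⊆ Q.intactEdges.subtype (fun e => e ∈ Q.EL) := by
  rw [← biUnion_f_inter_cut, and_iff_right hCB, Finset.inter_left_comm,
    Finset.inter_eq_left.2 (Finset.biUnion_subset_biUnion_of_subset_left _ hCB),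
    Finset.inter_comm]

theorem subset_subtype {α : Type*} [DecidableEq α] {P : GT α} {I : Finset (Finset α)}
    {C : Finset {e // e ∈ P.EL}} (hC : C.image Subtype.val ⊆ I) :
    C ⊆ I.subtype (fun e => e ∈ P.EL) :=
  fun _ he => Finset.mem_subtype.2 (hC (Finset.mem_image_of_mem _ he))

end GF

/-! ### Matching the two coproducts term by term. -/

/-- A map from pairs to symbols which sends sub- and co-pairs to the restrictions of the symbol of
the parent intertwines `ΔGT` with `Δc`. -/
theorem Δc_linearCombination {α : Type*} [DecidableEq α] (Q : GF α) (φ : GF α → Alg Q.f)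
    (s : Sym Q.f) (hs : φ Q = Alg.sym s) (hunit : φ (GT.unit α).toForest = Alg.sym Alg.oneSym)
    (hpow : ∀ C, C ⊆ s.B ∧ C.biUnion Q.f ∩ s.lo = ∅ ↔
      C ⊆ Q.intactEdges.subtype (fun e => e ∈ Q.EL))
    (hsub : ∀ (C : Finset {e // e ∈ Q.EL}) (hC : C.image Subtype.val ⊆ Q.intactEdges),
      φ (Q.sub _ (GF.image_cycle_subset hC)).toForest = Alg.sym (Alg.restrict s C))
    (hco : ∀ (C : Finset {e // e ∈ Q.EL}) (hC : C.image Subtype.val ⊆ Q.intactEdges),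
      φ (Q.co _ (GF.image_cycle_subset hC)) = Alg.sym (Alg.restrict s (s.B \ C))) :
    Alg.Δc (Finsupp.linearCombination ℚ φ (Finsupp.single Q 1)) =
      TensorProduct.map (Finsupp.linearCombination ℚ φ ∘ₗ incl) (Finsupp.linearCombination ℚ φ)
        (ΔGT (Finsupp.single Q 1)) := by
  classical
  have hincl : ∀ R : GT α, (Finsupp.linearCombination ℚ φ ∘ₗ incl) (Finsupp.single R 1) =
      φ R.toForest := fun R => by
    simp [incl]
  have hφ : ∀ R : GF α, Finsupp.linearCombination ℚ φ (Finsupp.single R 1) = φ R := fun R => by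
    simp
  have hfilter : (s.B.powerset.filter fun C => C.biUnion Q.f ∩ s.lo = ∅) =
      (Q.intactEdges.subtype (fun e => e ∈ Q.EL)).powerset := by
    ext C
    rw [Finset.mem_filter, Finset.mem_powerset, Finset.mem_powerset, hpow]
  rw [hφ, hs, Alg.Δc, Alg.lift_sym, ΔGT, Finsupp.linearCombination_single, one_smul, map_add,
    map_sum, TensorProduct.map_tmul, hincl, hφ, hunit, hs]
  simp only [TensorProduct.map_tmul, hincl, hφ]
  -- The term `C = ∅` is `1 ⊗ s`, the image of `𝕀 ⊗ (Γ,F)`.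
  rw [hfilter, ← Finset.add_sum_erase _ _ (Finset.empty_mem_powerset _), Alg.restrict_empty,
    Finset.sdiff_empty, Alg.restrict_self]
  congr 1
  have hC : ∀ C ∈ (Q.intactEdges.subtype (fun e => e ∈ Q.EL)).powerset.erase ∅,
      C.image Subtype.val ⊆ Q.intactEdges := fun C hC =>
    GF.image_val_subset (Finset.mem_powerset.1 (Finset.mem_of_mem_erase hC))
  -- Nonempty sets of intact edges are matched with nonempty sets of intact cycles by `e ↦ l(T,e)`.
  refine Finset.sum_bij
    (fun C h => ⟨(C.image Subtype.val).image Q.cycle, Finset.mem_erase.2 ⟨?_,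
      Finset.mem_powerset.2 (GF.image_cycle_subset (hC C h))⟩⟩) ?_ ?_ ?_ ?_
  · simpa using Finset.ne_of_mem_erase h
  · exact fun _ _ => Finset.mem_attach _ _
  · intro C _ C' _ h
    have h' := Subtype.ext_iff.1 h
    simp only [Finset.image_image] at h'
    refine Finset.image_injective ?_ h'
    exact fun a b hab => Subtype.ext (Q.cycle_injOn a.2 b.2 hab)
  · rintro ⟨p, hp⟩ -
    obtain ⟨hp₀, hp⟩ := Finset.mem_erase.1 hp
    obtain ⟨D, hD, rfl⟩ := Finset.subset_image_iff.1 (Finset.mem_powerset.1 hp)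
    have hDi : (D.subtype (fun e => e ∈ Q.EL)).image Subtype.val = D := by
      ext e
      simp only [Finset.mem_image, Finset.mem_subtype, Subtype.exists, exists_and_left,
        exists_prop, exists_eq_right_right]
      exact and_iff_left_of_imp fun h => Q.intactEdges_subset (hD h)
    refine ⟨D.subtype _, Finset.mem_erase.2 ⟨?_, Finset.mem_powerset.2 fun e he => ?_⟩,
      Subtype.ext (by simp only [hDi])⟩
    · intro h
      rw [h] at hDi
      exact hp₀ (by rw [← hDi]; simp)
    · exact Finset.mem_subtype.2 (hD (Finset.mem_subtype.1 he))
  · intro C h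
    rw [hsub C (hC C h), hco C (hC C h)]

/-- With `B = E_L` the condition in `Δc` does real work: it discards every `B₁` containing an edge
with a cut cycle. Of the quotient only its non-tree and cut edges matter. -/
theorem Δc_wSymbol {α : Type*} [DecidableEq α] (Q : GF α) :
    Alg.Δc (wSymbol Q.toGT (Finsupp.single Q 1)) =
      TensorProduct.map (wSymbol Q.toGT ∘ₗ incl) (wSymbol Q.toGT)
        (ΔGT (Finsupp.single Q 1)) := by
  have hQ : Q.LivesIn Q.toGT := ⟨subset_rfl, subset_rfl⟩
  refine Δc_linearCombination Q (symbolOf Q.toGT)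
    ⟨Finset.univ, Q.cut ∩ Finset.univ.biUnion Q.f, Q.T ∩ Finset.univ.biUnion Q.f,
      Finset.inter_subset_inter_right hQ.cut_sub, Finset.inter_subset_right⟩ ?_ ?_ ?_ ?_ ?_
  · exact symbolOf_eq hQ (fun e => iff_of_true (Finset.mem_univ _) e.2) rfl rfl
  · refine symbolOf_eq (GF.unit_livesIn _) (fun e => ?_) ?_ ?_
    · exact iff_of_false (Finset.notMem_empty _) (by
        simp [GT.toForest, GT.unit, GT.EL, HGraph.empty])
    · simp [Alg.oneSym]
    · simp [Alg.oneSym]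
  · exact fun C => GF.subset_and_biUnion_f_inter_cut (Finset.subset_univ _)
  · intro C hC
    refine symbolOf_eq (GF.sub_livesIn hC) (fun e => ?_) ?_
      (Alg.restrict_hi rfl (Finset.subset_univ _))
    · have h : (Q.sub _ (GF.image_cycle_subset hC)).toForest.EL = _ := GF.sub_EL hC
      rw [h]
      exact GF.mem_image_val.symm
    -- The sub-pair has no cuts, and the trace of the cut set of `Q` on `f(C)` is empty because `C`
    -- is intact.
    · rw [Alg.restrict_lo rfl (Finset.subset_univ _), GF.toForest_cut, Finset.inter_comm,
        GF.biUnion_f_inter_cut.2 (GF.subset_subtype hC), Finset.empty_inter]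
  · intro C hC
    refine symbolOf_eq (GF.co_livesIn hC) (fun e => ?_) ?_
      (Alg.restrict_hi rfl (Finset.subset_univ _))
    · rw [GF.co_EL hC, Finset.mem_sdiff, GF.mem_image_val, and_iff_right e.2]
      exact Finset.mem_sdiff.trans (and_iff_right (Finset.mem_univ _))
    · rw [GF.co_cut hC]
      exact Alg.restrict_lo rfl (Finset.subset_univ _)

/-- With `B = I` every subset of `B` satisfies the condition in `Δc`; the content moves to the
right-hand factor, where `co_intactEdges` is needed. -/
theorem Δc_w {α : Type*} [DecidableEq α] (Q : GF α) :
    Alg.Δc (w Q.toGT (Finsupp.single Q 1)) =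
      TensorProduct.map (w Q.toGT ∘ₗ incl) (w Q.toGT)
        (ΔGT (Finsupp.single Q 1)) := by
  have hQ : Q.LivesIn Q.toGT := ⟨subset_rfl, subset_rfl⟩
  refine Δc_linearCombination Q (monomialOf Q.toGT)
    ⟨(Q.intactEdges.subtype fun e => e ∈ Q.EL), Q.cut ∩ (Q.intactEdges.subtype fun e => e ∈ Q.EL).biUnion Q.f, Q.T ∩ (Q.intactEdges.subtype fun e => e ∈ Q.EL).biUnion Q.f,
      Finset.inter_subset_inter_right hQ.cut_sub, Finset.inter_subset_right⟩ ?_ ?_ ?_ ?_ ?_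
  · exact monomialOf_eq hQ (fun e => Finset.mem_subtype) rfl rfl
  · refine monomialOf_eq (GF.unit_livesIn _) (fun e => ?_) ?_ ?_
    · rw [GF.toForest_intactEdges]
      exact iff_of_false (Finset.notMem_empty _) (by simp [GT.unit, GT.EL, HGraph.empty])
    · simp [Alg.oneSym]
    · simp [Alg.oneSym]
  · exact fun C => ⟨fun h => h.1, fun h => (GF.subset_and_biUnion_f_inter_cut h).2 h⟩
  · intro C hC
    refine monomialOf_eq (GF.sub_livesIn hC) (fun e => ?_) ?_
      (Alg.restrict_hi rfl (GF.subset_subtype hC))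
    · rw [GF.toForest_intactEdges, GF.sub_EL hC]
      exact GF.mem_image_val.symm
    · rw [Alg.restrict_lo rfl (GF.subset_subtype hC), GF.toForest_cut, Finset.inter_comm,
        GF.biUnion_f_inter_cut.2 (GF.subset_subtype hC), Finset.empty_inter]
  · intro C hC
    refine monomialOf_eq (GF.co_livesIn hC) (fun e => ?_) ?_
      (Alg.restrict_hi rfl Finset.sdiff_subset)
    · rw [GF.co_intactEdges hC, Finset.mem_sdiff, GF.mem_image_val]
      exact Finset.mem_sdiff.trans (and_congr_left fun _ => Finset.mem_subtype)
    · rw [GF.co_cut hC]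
      exact Alg.restrict_lo rfl Finset.sdiff_subset

end CutGraphs

theorem mainTheorem9 {α : Type*} [DecidableEq α] (P : CutGraphs.GT α)
    (F : Finset (Finset α)) (hF : F ⊆ P.T) :
    CutGraphs.Alg.Δc (CutGraphs.w P (Finsupp.single ⟨P, F, hF⟩ 1)) =
      TensorProduct.map (CutGraphs.w P ∘ₗ CutGraphs.incl) (CutGraphs.w P)
        (CutGraphs.ΔGT (Finsupp.single ⟨P, F, hF⟩ 1)) ∧
    CutGraphs.Alg.Δc (CutGraphs.wSymbol P (Finsupp.single ⟨P, F, hF⟩ 1)) =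
      TensorProduct.map (CutGraphs.wSymbol P ∘ₗ CutGraphs.incl) (CutGraphs.wSymbol P)
        (CutGraphs.ΔGT (Finsupp.single ⟨P, F, hF⟩ 1)) := by
  exact ⟨CutGraphs.Δc_w ⟨P, F, hF⟩, CutGraphs.Δc_wSymbol ⟨P, F, hF⟩⟩
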